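/- Let $\nu\ge 1$, $\hbar>0$, $\mathcal H_n=L^2(\mathbb R^{\nu n})$ ($\mathcal H_0=\mathbb C$), and let $\Phi^{(k)}$, $k\ge1$, be real symmetric $k$-body potentials satisfying Kato's condition (multiplication by $\Phi^{(k)}$ is bounded relative to the Laplacian on $\mathbb R^{\nu k}$ with relative bound $0$). Let $H_n$ be the self-adjoint operator which on $C_c^\infty(\mathbb R^{\nu n})$ is $$H_n=-\frac{\hbar^2}{2}\sum_{i=1}^n\Delta_{q_i}+\sum_{k=1}^n\sum_{i_1<\dots<i_k}\Phi^{(k)}(q_{i_1},\dots,q_{i_k}),$$ and put $\mathcal G_n(t)g=e^{\frac i\hbar tH_n}\,g\,e^{-\frac i\hbar tH_n}$. For a set $A$ of particles, $\mathcal G_{|A|}(t,A)$ is this evolution acting on the particles in $A$; for a $k$-particle operator $g_k$, $g_k(j_1,\dots,j_k)$ is the operator acting as $g_k$ on the particles $j_1,\dots,j_k$ and trivially on the others. For $\gamma,\alpha>0$ let $\mathfrak L_\gamma$ be the space of sequences $g=(g_n)_{n\ge0}$ of bounded operators $g_n$ on $\mathcal H_n$, invariant under permutations of the particles, with $$\|g\|_{\mathfrak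 L_\gamma}=\sup_{n\ge0}\frac{\gamma^n}{n!}\|g_n\|<\infty ,$$ and let $\mathfrak L^1_\alpha$ be the space of sequences $f=(f_n)_{n\ge0}$ of permutation invariant trace class operators on $\mathcal H_n$ with $$\|f\|_{\mathfrak L^1_\alpha}=\sum_{n\ge0}\alpha^n\,\mathrm{Tr}\,|f_n|<\infty .$$ For a sequence $G(0)=(G_n(0))_{n\ge 0}$ of bounded operators, let $G(t)$ be the solution of the quantum dual BBGKY hierarchy given, with $Y=(1,\dots,s)$ and $X=Y\setminus\{j_1,\dots,j_{s-n}\}$, by $G_0(t)=G_0(0)$ and, for $s\ge1$, $$G_s(t)=\sum_{n=0}^s\frac1{(s-n)!}\sum_{j_1\ne\dots\ne j_{s-n}=1}^s\mathfrak A^+_{1+n}\big(t,(Y\setminus X)_1,X\big)\,G_{s-n}(0;j_1,\dots,j_{s-n}),$$ $$\mathfrak A^+_{1+n}\big(t,(Y\setminus X)_1,X\big)=\sum_{P}(-1)^{|P|-1}(|P|-1)!\prod_{X_i\in P}\mathcal G_{|X_i|}(t,X_i),$$ where $P$ runs over the partitions, into nonempty blocks, of the set of $1+n$ elements consisting of the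 cluster $(Y\setminus X)_1=\{j_1,\dots,j_{s-n}\}$, counted as one element, and of the $n$ particles of $X$; in $\mathcal G_{|X_i|}(t,X_i)$ the block $X_i$ is read as the set of all particles contained in it. Let $\alpha=\gamma^{-1}>e$, $F(0)\in\mathfrak L^1_\alpha$ and $t\in\mathbb R$. 1. If $G(0)\in\mathfrak L_\gamma$, then every operator $G_s(t)F_s(0)$ is of trace class, the series $$\langle G(t)|F(0)\rangle=\sum_{s=0}^\infty\frac1{s!}\,\mathrm{Tr}\,\big(G_s(t)F_s(0)\big)$$ converges absolutely, and $$\big|\langle G(t)|F(0)\rangle\big|\le e^2(1-\gamma e)^{-1}\,\|G(0)\|_{\mathfrak L_\gamma}\,\|F(0)\|_{\mathfrak L^1_{\gamma^{-1}}}.$$ 2. For the number of particles $N(0)=(0,I,0,0,\dots)$ one has $N(t)=N(0)$, hence $\langle N(t)|F(0)\rangle=\mathrm{Tr}\,F_1(0)$, and $|\mathrm{Tr}\,F_1(0)|\le\|F(0)\|_{\mathfrak L^1_{\gamma^{-1}}}<\infty$. -/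

import Mathlib

open MeasureTheory Filter Topology Finset
open scoped ENNReal NNReal ContDiff InnerProductSpace ComplexConjugate

set_option linter.unusedSectionVars false

noncomputable section

namespace DualBBGKY

/-! ### Tensor products of square integrable functions -/

section Tensor

variable {X Y Z : Type*} [MeasurableSpace X] [MeasurableSpace Y] [MeasurableSpace Z]
  {μ : Measure X} {ν : Measure Y} {ρ : Measure Z} [SigmaFinite μ] [SigmaFinite ν]

theorem tensor_memLp {e : Z ≃ᵐ X × Y} (he : MeasurePreserving e ρ (μ.prod ν))
    (φ : Lp ℂ 2 μ) (ψ : Lp ℂ 2 ν) :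
    MemLp (fun z => φ (e z).1 * ψ (e z).2) 2 ρ := by
  have key : MemLp (fun p : X × Y => φ p.1 * ψ p.2) 2 (μ.prod ν) := by
    have hm : AEStronglyMeasurable (fun p : X × Y => φ p.1 * ψ p.2) (μ.prod ν) :=
      ((Lp.memLp φ).1.comp_fst).mul ((Lp.memLp ψ).1.comp_snd)
    rw [memLp_two_iff_integrable_sq_norm hm]
    have h1 := (memLp_two_iff_integrable_sq_norm (Lp.memLp φ).1).1 (Lp.memLp φ)
    have h2 := (memLp_two_iff_integrable_sq_norm (Lp.memLp ψ).1).1 (Lp.memLp ψ)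
    refine (h1.mul_prod h2).congr (Eventually.of_forall fun p => ?_)
    simp [mul_pow]
  exact key.comp_measurePreserving he

/-- The function `z ↦ φ (x z) * ψ (y z)` as an element of `L²`, where `e z = (x z, y z)`. -/
def tensorVec {e : Z ≃ᵐ X × Y} (he : MeasurePreserving e ρ (μ.prod ν))
    (ψ : Lp ℂ 2 ν) (φ : Lp ℂ 2 μ) : Lp ℂ 2 ρ :=
  (tensor_memLp he φ ψ).toLp _

theorem coeFn_tensorVec {e : Z ≃ᵐ X × Y} (he : MeasurePreserving e ρ (μ.prod ν))
    (ψ : Lp ℂ 2 ν) (φ : Lp ℂ 2 μ) :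
    tensorVec he ψ φ =ᵐ[ρ] fun z => φ (e z).1 * ψ (e z).2 :=
  MemLp.coeFn_toLp _

theorem ae_fst {e : Z ≃ᵐ X × Y} (he : MeasurePreserving e ρ (μ.prod ν)) {p : X → Prop}
    (h : ∀ᵐ x ∂μ, p x) : ∀ᵐ z ∂ρ, p (e z).1 :=
  (Measure.quasiMeasurePreserving_fst.comp he.quasiMeasurePreserving).ae h

theorem ae_snd {e : Z ≃ᵐ X × Y} (he : MeasurePreserving e ρ (μ.prod ν)) {p : Y → Prop}
    (h : ∀ᵐ x ∂ν, p x) : ∀ᵐ z ∂ρ, p (e z).2 :=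
  (Measure.quasiMeasurePreserving_snd.comp he.quasiMeasurePreserving).ae h

theorem tensorVec_add_right {e : Z ≃ᵐ X × Y} (he : MeasurePreserving e ρ (μ.prod ν))
    (ψ : Lp ℂ 2 ν) (φ φ' : Lp ℂ 2 μ) :
    tensorVec he ψ (φ + φ') = tensorVec he ψ φ + tensorVec he ψ φ' := by
  apply Lp.ext
  filter_upwards [coeFn_tensorVec he ψ (φ + φ'), coeFn_tensorVec he ψ φ,
    coeFn_tensorVec he ψ φ', Lp.coeFn_add (tensorVec he ψ φ) (tensorVec he ψ φ'),
    ae_fst he (Lp.coeFn_add φ φ')] with z h1 h2 h3 h4 h5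
  rw [h1, h4, Pi.add_apply, h2, h3, h5, Pi.add_apply, add_mul]

theorem tensorVec_smul_right {e : Z ≃ᵐ X × Y} (he : MeasurePreserving e ρ (μ.prod ν))
    (ψ : Lp ℂ 2 ν) (c : ℂ) (φ : Lp ℂ 2 μ) :
    tensorVec he ψ (c • φ) = c • tensorVec he ψ φ := by
  apply Lp.ext
  filter_upwards [coeFn_tensorVec he ψ (c • φ), coeFn_tensorVec he ψ φ,
    Lp.coeFn_smul c (tensorVec he ψ φ), ae_fst he (Lp.coeFn_smul c φ)] with z h1 h2 h4 h5
  rw [h1, h4, Pi.smul_apply, h2, h5, Pi.smul_apply, smul_eq_mul, smul_eq_mul, mul_assoc]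

theorem tensorVec_add_left {e : Z ≃ᵐ X × Y} (he : MeasurePreserving e ρ (μ.prod ν))
    (ψ ψ' : Lp ℂ 2 ν) (φ : Lp ℂ 2 μ) :
    tensorVec he (ψ + ψ') φ = tensorVec he ψ φ + tensorVec he ψ' φ := by
  apply Lp.ext
  filter_upwards [coeFn_tensorVec he (ψ + ψ') φ, coeFn_tensorVec he ψ φ,
    coeFn_tensorVec he ψ' φ, Lp.coeFn_add (tensorVec he ψ φ) (tensorVec he ψ' φ),
    ae_snd he (Lp.coeFn_add ψ ψ')] with z h1 h2 h3 h4 h5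
  rw [h1, h4, Pi.add_apply, h2, h3, h5, Pi.add_apply, mul_add]

theorem tensorVec_smul_left {e : Z ≃ᵐ X × Y} (he : MeasurePreserving e ρ (μ.prod ν))
    (ψ : Lp ℂ 2 ν) (c : ℂ) (φ : Lp ℂ 2 μ) :
    tensorVec he (c • ψ) φ = c • tensorVec he ψ φ := by
  apply Lp.ext
  filter_upwards [coeFn_tensorVec he (c • ψ) φ, coeFn_tensorVec he ψ φ,
    Lp.coeFn_smul c (tensorVec he ψ φ), ae_snd he (Lp.coeFn_smul c ψ)] with z h1 h2 h4 h5
  rw [h1, h4, Pi.smul_apply, h2, h5, Pi.smul_apply, smul_eq_mul, smul_eq_mul, mul_left_comm]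

theorem inner_tensorVec {e : Z ≃ᵐ X × Y} (he : MeasurePreserving e ρ (μ.prod ν))
    (ψ ψ' : Lp ℂ 2 ν) (φ φ' : Lp ℂ 2 μ) :
    inner ℂ (tensorVec he ψ φ) (tensorVec he ψ' φ') = inner ℂ φ φ' * inner ℂ ψ ψ' := by
  rw [L2.inner_def, L2.inner_def, L2.inner_def, ← integral_prod_mul,
    ← he.integral_comp e.measurableEmbedding]
  refine integral_congr_ae ?_
  filter_upwards [coeFn_tensorVec he ψ φ, coeFn_tensorVec he ψ' φ'] with z h1 h2
  rw [h1, h2]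
  simp only [RCLike.inner_apply, map_mul]
  ring

theorem norm_tensorVec {e : Z ≃ᵐ X × Y} (he : MeasurePreserving e ρ (μ.prod ν))
    (ψ : Lp ℂ 2 ν) (φ : Lp ℂ 2 μ) : ‖tensorVec he ψ φ‖ = ‖φ‖ * ‖ψ‖ := by
  have h := inner_tensorVec he ψ ψ φ φ
  rw [inner_self_eq_norm_sq_to_K, inner_self_eq_norm_sq_to_K, inner_self_eq_norm_sq_to_K,
    ← mul_pow] at h
  have h' : ‖tensorVec he ψ φ‖ ^ 2 = (‖φ‖ * ‖ψ‖) ^ 2 := by exact_mod_cast h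
  exact (pow_left_inj₀ (norm_nonneg _) (by positivity) two_ne_zero).1 h'

/-- The bounded operator `φ ↦ φ ⊗ ψ`. -/
def tensorRight {e : Z ≃ᵐ X × Y} (he : MeasurePreserving e ρ (μ.prod ν)) (ψ : Lp ℂ 2 ν) :
    Lp ℂ 2 μ →L[ℂ] Lp ℂ 2 ρ :=
  LinearMap.mkContinuous
    { toFun := tensorVec he ψ
      map_add' := tensorVec_add_right he ψ
      map_smul' := fun c φ => tensorVec_smul_right he ψ c φ } ‖ψ‖
    fun φ => by
      change ‖tensorVec he ψ φ‖ ≤ _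
      rw [norm_tensorVec, mul_comm]

@[simp] theorem tensorRight_apply {e : Z ≃ᵐ X × Y} (he : MeasurePreserving e ρ (μ.prod ν))
    (ψ : Lp ℂ 2 ν) (φ : Lp ℂ 2 μ) : tensorRight he ψ φ = tensorVec he ψ φ := rfl

/-- The bounded operator `ψ ↦ φ ⊗ ψ`. -/
def tensorLeft {e : Z ≃ᵐ X × Y} (he : MeasurePreserving e ρ (μ.prod ν)) (φ : Lp ℂ 2 μ) :
    Lp ℂ 2 ν →L[ℂ] Lp ℂ 2 ρ :=
  LinearMap.mkContinuous
    { toFun := fun ψ => tensorVec he ψ φ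
      map_add' := fun ψ ψ' => tensorVec_add_left he ψ ψ' φ
      map_smul' := fun c ψ => tensorVec_smul_left he ψ c φ } ‖φ‖
    fun ψ => by
      change ‖tensorVec he ψ φ‖ ≤ _
      rw [norm_tensorVec]

/-- Product functions are total in `L²` of a product. -/
theorem tensor_total {e : Z ≃ᵐ X × Y} (he : MeasurePreserving e ρ (μ.prod ν)) (Ψ : Lp ℂ 2 ρ)
    (h : ∀ φ ψ, inner ℂ (tensorVec he ψ φ) Ψ = 0) : Ψ = 0 := by
  have hes : MeasurePreserving e.symm (μ.prod ν) ρ := he.symm e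
  set f : X × Y → ℂ := fun p => Ψ (e.symm p) with hf
  have hfm : MemLp f 2 (μ.prod ν) := (Lp.memLp Ψ).comp_measurePreserving hes
  have rect : ∀ A B, MeasurableSet A → MeasurableSet B → μ A ≠ ⊤ → ν B ≠ ⊤ →
      ∫ p in A ×ˢ B, f p ∂(μ.prod ν) = 0 := by
    intro A B hA hB hμ hν
    have h0 := h (indicatorConstLp 2 hA hμ 1) (indicatorConstLp 2 hB hν 1)
    rw [L2.inner_def, ← hes.integral_comp e.symm.measurableEmbedding] at h0
    rw [← h0, ← integral_indicator (hA.prod hB)]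
    refine integral_congr_ae ?_
    have h1 := hes.quasiMeasurePreserving.ae
      (coeFn_tensorVec he (indicatorConstLp 2 hB hν 1) (indicatorConstLp 2 hA hμ 1))
    filter_upwards [h1,
      Measure.quasiMeasurePreserving_fst.ae (indicatorConstLp_coeFn (p := 2) (hs := hA) (hμs := hμ)
        (c := (1 : ℂ))),
      Measure.quasiMeasurePreserving_snd.ae (indicatorConstLp_coeFn (p := 2) (hs := hB) (hμs := hν)
        (c := (1 : ℂ)))] with p h1 h2 h3
    rw [h1, e.apply_symm_apply, h2, h3]
    by_cases hpA : p.1 ∈ A <;> by_cases hpB : p.2 ∈ B <;> simp [hpA, hpB, hf]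
  have loc : ∀ n, f =ᵐ[(μ.prod ν).restrict (spanningSets μ n ×ˢ spanningSets ν n)] 0 := by
    intro n
    set R := spanningSets μ n ×ˢ spanningSets ν n with hR
    have hRm : MeasurableSet R :=
      (measurableSet_spanningSets μ n).prod (measurableSet_spanningSets ν n)
    have hRfin : (μ.prod ν) R ≠ ⊤ := by
      rw [hR, Measure.prod_prod]
      exact ENNReal.mul_ne_top (measure_spanningSets_lt_top μ n).ne
        (measure_spanningSets_lt_top ν n).ne
    have : IsFiniteMeasure ((μ.prod ν).restrict R) := ⟨by
      rw [Measure.restrict_apply_univ]; exact lt_top_iff_ne_top.2 hRfin⟩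
    have hint : Integrable f ((μ.prod ν).restrict R) :=
      (hfm.restrict R).integrable (by norm_num)
    refine hint.ae_eq_zero_of_forall_setIntegral_eq_zero fun s hs _ => ?_
    refine MeasurableSpace.induction_on_inter
      (C := fun s _ => ∫ p in s, f p ∂((μ.prod ν).restrict R) = 0)
      (generateFrom_prod (α := X) (β := Y)).symm isPiSystem_prod ?_ ?_ ?_ ?_ s hs
    · simp
    · rintro _ ⟨A, hA, B, hB, rfl⟩
      rw [Measure.restrict_restrict (MeasurableSet.prod hA hB), hR, Set.prod_inter_prod]
      refine rect _ _ (hA.inter (measurableSet_spanningSets μ n))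
        (hB.inter (measurableSet_spanningSets ν n)) ?_ ?_
      · exact ((measure_mono Set.inter_subset_right).trans_lt (measure_spanningSets_lt_top μ n)).ne
      · exact ((measure_mono Set.inter_subset_right).trans_lt (measure_spanningSets_lt_top ν n)).ne
    · intro t ht h0
      have hu : ∫ p, f p ∂((μ.prod ν).restrict R) = 0 :=
        rect _ _ (measurableSet_spanningSets μ n) (measurableSet_spanningSets ν n)
          (measure_spanningSets_lt_top μ n).ne (measure_spanningSets_lt_top ν n).ne
      have := integral_add_compl ht hint
      rw [h0, hu, zero_add] at this
      exact this
    · intro g hd hg h0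
      rw [integral_iUnion hg hd hint.integrableOn]
      simp [h0]
  have hall : f =ᵐ[μ.prod ν] 0 := by
    have hU : (⋃ n, spanningSets μ n ×ˢ spanningSets ν n) = (Set.univ : Set (X × Y)) := by
      rw [← Set.univ_prod_univ, ← iUnion_spanningSets μ, ← iUnion_spanningSets ν]
      exact Set.iUnion_prod_of_monotone (monotone_spanningSets μ) (monotone_spanningSets ν)
    have := (ae_restrict_iUnion_iff (μ := μ.prod ν)
      (fun n => spanningSets μ n ×ˢ spanningSets ν n) (fun p => f p = 0)).2 loc
    rw [hU, Measure.restrict_univ] at this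
    exact this
  apply Lp.ext
  filter_upwards [he.quasiMeasurePreserving.ae hall, Lp.coeFn_zero ℂ 2 ρ] with z h1 h2
  rw [h2]
  simpa [hf] using h1

/-- For every bounded `T` there is a bounded `B` with `B (φ ⊗ ψ) = (T φ) ⊗ ψ`. -/
theorem exists_ampliation {e : Z ≃ᵐ X × Y} (he : MeasurePreserving e ρ (μ.prod ν))
    (T : Lp ℂ 2 μ →L[ℂ] Lp ℂ 2 μ) :
    ∃ B : Lp ℂ 2 ρ →L[ℂ] Lp ℂ 2 ρ, ‖B‖ ≤ ‖T‖ ∧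
      ∀ φ ψ, B (tensorVec he ψ φ) = tensorVec he ψ (T φ) := by
  classical
  obtain ⟨w, b, -⟩ := exists_hilbertBasis ℂ (Lp ℂ 2 ν)
  let V : w → Lp ℂ 2 μ →ₗᵢ[ℂ] Lp ℂ 2 ρ := fun i =>
    { toLinearMap := (tensorRight he (b i)).toLinearMap
      norm_map' := fun φ => by
        change ‖tensorVec he (b i) φ‖ = ‖φ‖
        rw [norm_tensorVec, b.orthonormal.1 i, mul_one] }
  have hV : OrthogonalFamily ℂ (fun _ : w => Lp ℂ 2 μ) V := by
    intro i k hik φ φ'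
    change inner ℂ (tensorVec he (b i) φ) (tensorVec he (b k) φ') = 0
    rw [inner_tensorVec, b.orthonormal.2 hik, mul_zero]
  let J := hV.linearIsometry
  let D : lp (fun _ : w => Lp ℂ 2 μ) 2 →L[ℂ] lp (fun _ : w => Lp ℂ 2 μ) 2 :=
    lp.mapCLM 2 (fun _ => T) (norm_nonneg T) (fun _ => le_rfl)
  let Jc := J.toContinuousLinearMap
  have hJJ : ∀ f, ContinuousLinearMap.adjoint Jc (Jc f) = f := by
    intro f
    refine ext_inner_right ℂ fun g => ?_
    rw [ContinuousLinearMap.adjoint_inner_left]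
    exact J.inner_map_map f g
  have hJ1 : ‖Jc‖ ≤ 1 := J.norm_toContinuousLinearMap_le
  refine ⟨Jc ∘L D ∘L ContinuousLinearMap.adjoint Jc, ?_, ?_⟩
  · have hD : ‖D‖ ≤ ‖T‖ := lp.norm_mapCLM_le _ _ _ _
    have hJ2 : ‖ContinuousLinearMap.adjoint Jc‖ ≤ 1 := by
      rw [LinearIsometryEquiv.norm_map]; exact hJ1
    calc _ ≤ ‖Jc‖ * ‖D ∘L ContinuousLinearMap.adjoint Jc‖ := ContinuousLinearMap.opNorm_comp_le _ _
      _ ≤ 1 * (‖D‖ * ‖ContinuousLinearMap.adjoint Jc‖) := by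
          gcongr; exact ContinuousLinearMap.opNorm_comp_le _ _
      _ ≤ 1 * (‖T‖ * 1) := by gcongr
      _ = ‖T‖ := by ring
  · intro φ ψ
    set B := Jc ∘L D ∘L ContinuousLinearMap.adjoint Jc with hB
    have hbasis : ∀ i, B (tensorVec he (b i) φ) = tensorVec he (b i) (T φ) := by
      intro i
      have h1 : ∀ φ, tensorVec he (b i) φ = Jc (lp.single 2 i φ) := fun φ =>
        (hV.linearIsometry_apply_single (i := i) φ).symm
      rw [h1 φ, hB]
      simp only [ContinuousLinearMap.comp_apply]
      rw [hJJ, h1 (T φ)]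
      congr 1
      ext k : 2
      by_cases hk : k = i
      · subst hk; simp [D]
      · simp [D, hk]
    have : B ∘L tensorLeft he φ = tensorLeft he (T φ) := by
      refine ContinuousLinearMap.ext_on (s := Set.range b) ?_ ?_
      · rw [dense_iff_closure_eq, ← Submodule.topologicalClosure_coe, b.dense_span]; rfl
      · rintro _ ⟨i, rfl⟩
        exact hbasis i
    exact congrArg (fun A : Lp ℂ 2 ν →L[ℂ] Lp ℂ 2 ρ => A ψ) this

theorem existsUnique_ampliation {e : Z ≃ᵐ X × Y} (he : MeasurePreserving e ρ (μ.prod ν))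
    (T : Lp ℂ 2 μ →L[ℂ] Lp ℂ 2 μ) :
    ∃! B : Lp ℂ 2 ρ →L[ℂ] Lp ℂ 2 ρ, ∀ φ ψ, B (tensorVec he ψ φ) = tensorVec he ψ (T φ) := by
  obtain ⟨B, -, hB⟩ := exists_ampliation he T
  refine ⟨B, hB, fun B' hB' => ?_⟩
  have key : ContinuousLinearMap.adjoint B' = ContinuousLinearMap.adjoint B := by
    ext1 Ψ
    rw [← sub_eq_zero]
    refine tensor_total he _ fun φ ψ => ?_
    rw [inner_sub_right, ContinuousLinearMap.adjoint_inner_right,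
      ContinuousLinearMap.adjoint_inner_right, hB', hB, sub_self]
  exact ContinuousLinearMap.adjoint.injective key

end Tensor

/-! ### The `n`-particle spaces and operators acting on some of the particles -/

/-- The configuration space `ℝ^d` of one particle. -/
abbrev Pos (d : ℕ) : Type := EuclideanSpace ℝ (Fin d)

/-- The space `L²(ℝ^{d|ι|})` for particles labelled by a finite type `ι`; for `ι = Fin n` this is the
`n`-particle Hilbert space (for `n = 0` it is the one-dimensional space `L²(ℝ⁰) = ℂ`). -/
abbrev HSpace (d : ℕ) (ι : Type) [Fintype ι] : Type :=
  Lp ℂ 2 (volume : Measure (ι → Pos d))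

/-- Bounded operators on the `n`-particle Hilbert space. -/
abbrev Op (d n : ℕ) : Type := HSpace d (Fin n) →L[ℂ] HSpace d (Fin n)

/-- The labels in `Fin s` of the particles that are not among `j 0, …, j (k-1)`. -/
abbrev Rest {k s : ℕ} (j : Fin k ↪ Fin s) : Type := {i : Fin s // i ∉ Set.range j}

/-- The labels of `s` particles are split into those of the form `j a` and the others. -/
def labelEquiv {k s : ℕ} (j : Fin k ↪ Fin s) : Fin k ⊕ Rest j ≃ Fin s :=
  ((Equiv.ofInjective j j.injective).sumCongr (Equiv.refl _)).trans
    (Equiv.sumCompl fun i => i ∈ Set.range j)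

/-- The splitting `q ↦ (q ∘ j, q restricted to the other particles)` of a configuration. -/
def splitEquiv (d : ℕ) {k s : ℕ} (j : Fin k ↪ Fin s) :
    (Fin s → Pos d) ≃ᵐ (Fin k → Pos d) × (Rest j → Pos d) :=
  (MeasurableEquiv.piCongrLeft (fun _ => Pos d) (labelEquiv j)).symm.trans
    (MeasurableEquiv.sumPiEquivProdPi fun _ => Pos d)

theorem splitEquiv_apply (d : ℕ) {k s : ℕ} (j : Fin k ↪ Fin s) (q : Fin s → Pos d) :
    splitEquiv d j q = (fun a => q (j a), fun b => q b.1) := by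
  rfl

theorem splitEquiv_measurePreserving (d : ℕ) {k s : ℕ} (j : Fin k ↪ Fin s) :
    MeasurePreserving (splitEquiv d j) volume
      ((volume : Measure (Fin k → Pos d)).prod (volume : Measure (Rest j → Pos d))) :=
  (volume_measurePreserving_sumPiEquivProdPi fun _ => Pos d).comp
    ((volume_measurePreserving_piCongrLeft (fun _ => Pos d) (labelEquiv j)).symm _)

/-- The operator on `s` particles that acts as the `k`-particle operator `T` on the particles
`j 0, …, j (k-1)` (in this order) and trivially on the others, i.e. `T(j₁, …, j_k)`: the unique
bounded operator with `φ(q_{j₁}, …, q_{j_k}) ψ(rest) ↦ (T φ)(q_{j₁}, …, q_{j_k}) ψ(rest)`. -/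
def onParticles {d k s : ℕ} (j : Fin k ↪ Fin s) (T : Op d k) : Op d s :=
  (existsUnique_ampliation (splitEquiv_measurePreserving d j) T).choose

theorem onParticles_tensorVec {d k s : ℕ} (j : Fin k ↪ Fin s) (T : Op d k)
    (φ : HSpace d (Fin k)) (ψ : HSpace d (Rest j)) :
    onParticles j T (tensorVec (splitEquiv_measurePreserving d j) ψ φ) =
      tensorVec (splitEquiv_measurePreserving d j) ψ (T φ) :=
  (existsUnique_ampliation (splitEquiv_measurePreserving d j) T).choose_spec.1 φ ψ

/-- Maxwell--Boltzmann symmetry: `T(1, …, n) = T(i₁, …, i_n)` for every permutation. -/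
def IsSymmetricOp {d n : ℕ} (T : Op d n) : Prop :=
  ∀ σ : Equiv.Perm (Fin n), onParticles σ.toEmbedding T = T

/-! ### Trace class operators -/

section Trace

variable {E : Type*} [NormedAddCommGroup E] [InnerProductSpace ℂ E] [CompleteSpace E]

/-- The index set of a fixed Hilbert basis of `E`. -/
def basisIndex (E : Type*) [NormedAddCommGroup E] [InnerProductSpace ℂ E] [CompleteSpace E] :
    Set E :=
  (exists_hilbertBasis ℂ E).choose

/-- A fixed Hilbert basis of `E`. The trace norm of any operator and the trace of a trace class
operator do not depend on it. -/
def basis (E : Type*) [NormedAddCommGroup E] [InnerProductSpace ℂ E] [CompleteSpace E] :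
    HilbertBasis (basisIndex E) ℂ E :=
  (exists_hilbertBasis ℂ E).choose_spec.choose

/-- The trace norm `Tr |T|`, where `|T| = (T* T)^{1/2}`, with values in `[0, ∞]`. -/
def traceNorm (T : E →L[ℂ] E) : ℝ≥0∞ :=
  ∑' i, ENNReal.ofReal (inner ℂ (basis E i) (CFC.abs T (basis E i))).re

def IsTraceClass (T : E →L[ℂ] E) : Prop := traceNorm T < ⊤

/-- The trace of a trace class operator. -/
def trace (T : E →L[ℂ] E) : ℂ := ∑' i, inner ℂ (basis E i) (T (basis E i))

end Trace

/-! ### The Hamiltonian and the evolution of finitely many particles -/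

/-- `∑ᵢ Δ_{qᵢ} f`. -/
def totalLaplacian {d n : ℕ} (f : (Fin n → Pos d) → ℂ) (q : Fin n → Pos d) : ℂ :=
  ∑ i, Laplacian.laplacian (fun x : Pos d => f (Function.update q i x)) (q i)

/-- Test functions: infinitely differentiable with compact support. -/
structure IsTestFun {d n : ℕ} (f : (Fin n → Pos d) → ℂ) : Prop where
  smooth : ContDiff ℝ ∞ f
  compact : HasCompactSupport f

/-- The total interaction energy `∑_{k=1}^n ∑_{i₁<…<i_k} Φ^{(k)}(q_{i₁}, …, q_{i_k})`. -/
def interaction {d : ℕ} (Φ : (k : ℕ) → (Fin k → Pos d) → ℝ) (n : ℕ) (q : Fin n → Pos d) : ℝ :=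
  ∑ k ∈ Finset.Icc 1 n, ∑ i : Fin k ↪o Fin n, Φ k (q ∘ i)

/-- `-(ħ²/2) ∑ᵢ Δ_{qᵢ} f + ∑_{k=1}^n ∑_{i₁<…<i_k} Φ^{(k)}(q_{i₁}, …, q_{i_k}) f`. -/
def hamiltonianFun (ħ : ℝ) {d : ℕ} (Φ : (k : ℕ) → (Fin k → Pos d) → ℝ) (n : ℕ)
    (f : (Fin n → Pos d) → ℂ) (q : Fin n → Pos d) : ℂ :=
  -((ħ ^ 2 / 2 : ℝ) : ℂ) * totalLaplacian f q + (interaction Φ n q : ℂ) * f q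

/-- Kato's condition on a real `k`-body potential of identical particles: multiplication by `Φ` is
bounded relative to the Laplacian with relative bound zero. -/
structure IsKatoPotential {d k : ℕ} (Φ : (Fin k → Pos d) → ℝ) : Prop where
  aestronglyMeasurable : AEStronglyMeasurable Φ volume
  symmetric : ∀ σ : Equiv.Perm (Fin k), (fun q => Φ (q ∘ σ)) =ᵐ[volume] Φ
  relBound : ∀ ε : ℝ, 0 < ε → ∃ C : ℝ, ∀ f : (Fin k → Pos d) → ℂ, IsTestFun f →
    eLpNorm (fun q => (Φ q : ℂ) * f q) 2 volume ≤
      ENNReal.ofReal ε * eLpNorm (totalLaplacian f) 2 volume +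
        ENNReal.ofReal C * eLpNorm f 2 volume

theorem IsTestFun.contDiff_slice {d n : ℕ} {f : (Fin n → Pos d) → ℂ} (hf : IsTestFun f)
    (q : Fin n → Pos d) (i : Fin n) :
    ContDiff ℝ ∞ (fun x : Pos d => f (Function.update q i x)) :=
  hf.smooth.comp (contDiff_update ∞ q i)

theorem hamiltonianFun_add (ħ : ℝ) {d : ℕ} (Φ : (k : ℕ) → (Fin k → Pos d) → ℝ) (n : ℕ)
    {f g : (Fin n → Pos d) → ℂ} (hf : IsTestFun f) (hg : IsTestFun g) :
    hamiltonianFun ħ Φ n (f + g) = hamiltonianFun ħ Φ n f + hamiltonianFun ħ Φ n g := by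
  funext q
  have h : totalLaplacian (f + g) q = totalLaplacian f q + totalLaplacian g q := by
    simp only [totalLaplacian, ← Finset.sum_add_distrib]
    refine Finset.sum_congr rfl fun i _ => ?_
    exact ((hf.contDiff_slice q i).contDiffAt.of_le (by norm_cast)).laplacian_add
      ((hg.contDiff_slice q i).contDiffAt.of_le (by norm_cast))
  simp only [hamiltonianFun, h, Pi.add_apply]
  ring

theorem hamiltonianFun_smul (ħ : ℝ) {d : ℕ} (Φ : (k : ℕ) → (Fin k → Pos d) → ℝ) (n : ℕ)
    (c : ℂ) {f : (Fin n → Pos d) → ℂ} (hf : IsTestFun f) :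
    hamiltonianFun ħ Φ n (c • f) = c • hamiltonianFun ħ Φ n f := by
  funext q
  have h : totalLaplacian (c • f) q = c * totalLaplacian f q := by
    simp only [totalLaplacian, Finset.mul_sum]
    refine Finset.sum_congr rfl fun i _ => ?_
    exact InnerProductSpace.laplacian_smul c
      ((hf.contDiff_slice q i).contDiffAt.of_le (by norm_cast))
  simp only [hamiltonianFun, h, Pi.smul_apply, smul_eq_mul]
  ring

/-- The graph of the Hamiltonian on the test functions. -/
def formalGraph (ħ : ℝ) {d : ℕ} (Φ : (k : ℕ) → (Fin k → Pos d) → ℝ) (n : ℕ) :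
    Submodule ℂ (HSpace d (Fin n) × HSpace d (Fin n)) where
  carrier := {p | ∃ f, IsTestFun f ∧ p.1 =ᵐ[volume] f ∧ p.2 =ᵐ[volume] hamiltonianFun ħ Φ n f}
  zero_mem' := by
    have h0 : IsTestFun (0 : (Fin n → Pos d) → ℂ) := ⟨contDiff_const, HasCompactSupport.zero⟩
    refine ⟨0, h0, Lp.coeFn_zero ℂ 2 _, ?_⟩
    have h := hamiltonianFun_smul ħ Φ n 0 h0
    rw [zero_smul, zero_smul] at h
    rw [h]
    exact Lp.coeFn_zero ℂ 2 _
  add_mem' := by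
    rintro p p' ⟨f, hf, h1, h2⟩ ⟨g, hg, h3, h4⟩
    refine ⟨f + g, ⟨hf.smooth.add hg.smooth, hf.compact.add hg.compact⟩,
      (Lp.coeFn_add _ _).trans (h1.add h3), ?_⟩
    rw [hamiltonianFun_add ħ Φ n hf hg]
    exact (Lp.coeFn_add _ _).trans (h2.add h4)
  smul_mem' := by
    rintro c p ⟨f, hf, h1, h2⟩
    refine ⟨c • f, ⟨hf.smooth.const_smul c, hf.compact.smul_left (f := fun _ => c)⟩,
      (Lp.coeFn_smul _ _).trans (h1.const_smul c), ?_⟩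
    rw [hamiltonianFun_smul ħ Φ n c hf]
    exact (Lp.coeFn_smul _ _).trans (h2.const_smul c)

/-- The `n`-particle Hamiltonian `H_n`: the closure of the operator given by `hamiltonianFun` on the
test functions (for Kato potentials the latter is essentially self-adjoint). -/
def hamiltonian (ħ : ℝ) {d : ℕ} (Φ : (k : ℕ) → (Fin k → Pos d) → ℝ) (n : ℕ) :
    HSpace d (Fin n) →ₗ.[ℂ] HSpace d (Fin n) :=
  (formalGraph ħ Φ n).toLinearPMap.closure

theorem formalGraph_functional (ħ : ℝ) {d : ℕ} (Φ : (k : ℕ) → (Fin k → Pos d) → ℝ) (n : ℕ) :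
    (formalGraph ħ Φ n).toLinearPMap.graph = formalGraph ħ Φ n := by
  refine Submodule.toLinearPMap_graph_eq _ ?_
  rintro ⟨u, v⟩ ⟨f, hf, h1, h2⟩ (h0 : u = 0)
  have hf0 : f = 0 := by
    have h3 : f =ᵐ[volume] (0 : (Fin n → Pos d) → ℂ) := by
      refine EventuallyEq.trans h1.symm ?_
      change u =ᵐ[volume] _
      rw [h0]
      exact Lp.coeFn_zero ℂ 2 _
    exact (Continuous.ae_eq_iff_eq volume hf.smooth.continuous continuous_const).1 h3
  have h := hamiltonianFun_smul ħ Φ n 0 hf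
  rw [zero_smul, zero_smul, ← hf0] at h
  rw [h, hf0] at h2
  exact Lp.ext (h2.trans (Lp.coeFn_zero ℂ 2 _).symm)

/-- `U` is the strongly continuous one-parameter unitary group with generator `i H`, i.e.
`U t = e^{itH}`. -/
structure IsUnitaryGroup {E : Type*} [NormedAddCommGroup E] [InnerProductSpace ℂ E]
    [CompleteSpace E] (H : E →ₗ.[ℂ] E) (U : ℝ → E →L[ℂ] E) : Prop where
  zero : U 0 = 1
  add : ∀ t t', U (t + t') = U t * U t'
  unitary : ∀ t, U t ∈ unitary (E →L[ℂ] E)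
  continuous : ∀ ψ, Continuous fun t => U t ψ
  generator : ∀ ψ χ, (ψ, χ) ∈ H.graph ↔ HasDerivAt (fun t => U t ψ) (Complex.I • χ) 0

open Classical in
/-- `e^{itH}` for a self-adjoint operator `H`: the unitary group generated by `i H`, which exists and
is unique by Stone's theorem. (For an operator that generates no unitary group: the identity.) -/
def expI {E : Type*} [NormedAddCommGroup E] [InnerProductSpace ℂ E] [CompleteSpace E]
    (H : E →ₗ.[ℂ] E) (t : ℝ) : E →L[ℂ] E :=
  if h : ∃ U, IsUnitaryGroup H U then h.choose t else 1

/-- `𝒰_n(t) = e^{(i/ħ) t H_n}`. Its inverse is `e^{-(i/ħ) t H_n} = 𝒰_n(-t)`. -/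
def evolutionOp (ħ : ℝ) {d : ℕ} (Φ : (k : ℕ) → (Fin k → Pos d) → ℝ) (n : ℕ) (t : ℝ) : Op d n :=
  expI (hamiltonian ħ Φ n) (t / ħ)

/-- `𝒰_{|A|}(t)` acting on the particles with labels in `A`. -/
def evolutionOn (ħ : ℝ) {d : ℕ} (Φ : (k : ℕ) → (Fin k → Pos d) → ℝ) {s : ℕ}
    (A : Finset (Fin s)) (t : ℝ) : Op d s :=
  onParticles (A.orderEmbOfFin rfl).toEmbedding (evolutionOp ħ Φ A.card t)

/-- The Heisenberg evolution `𝒢_{|A|}(t, A) g = 𝒰_{|A|}(t, A) g 𝒰_{|A|}⁻¹(t, A)` of the particles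
with labels in `A`, acting on the operators on `s` particles. -/
def heisenbergOn (ħ : ℝ) {d : ℕ} (Φ : (k : ℕ) → (Fin k → Pos d) → ℝ) {s : ℕ}
    (A : Finset (Fin s)) (t : ℝ) : Module.End ℂ (Op d s) :=
  LinearMap.mulLeftRight ℂ (evolutionOn ħ Φ A t, evolutionOn ħ Φ A (-t))

/-! ### Dual cumulants and the evolution of marginal observables -/

open Classical in
/-- The element of the set `{(Y∖X)₁, X}` to which a particle belongs: `none` is the cluster
`Y∖X = (j₁, …, j_k)` counted as one element, and the other particles are elements by themselves. -/
def clusterOf {k s : ℕ} (j : Fin k ↪ Fin s) (i : Fin s) : Option (Rest j) :=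
  if h : i ∈ Set.range j then none else some ⟨i, h⟩

open Classical in
/-- The labels of the particles in a set of elements of `{(Y∖X)₁, X}`. -/
def declusterize {k s : ℕ} (j : Fin k ↪ Fin s) (A : Finset (Option (Rest j))) :
    Finset (Fin s) :=
  Finset.univ.filter fun i => clusterOf j i ∈ A

open Classical in
/-- The dual cumulant `𝔄⁺_{1+n}(t, (Y∖X)₁, X) = ∑_P (-1)^{|P|-1} (|P|-1)! ∏_{X_i ∈ P} 𝒢(t, X_i)`,
where `Y = (1, …, s)`, `Y∖X = (j₁, …, j_k)`, `n = s - k` and `P` runs over the partitions of the set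
`{(Y∖X)₁, X}` of `1 + n` elements. The operators in the product commute, because they act on disjoint
sets of particles, so that the order of the factors is irrelevant. -/
def dualCumulant (ħ : ℝ) {d : ℕ} (Φ : (k : ℕ) → (Fin k → Pos d) → ℝ) {k s : ℕ}
    (j : Fin k ↪ Fin s) (t : ℝ) : Module.End ℂ (Op d s) :=
  ∑ P : Finpartition (Finset.univ : Finset (Option (Rest j))),
    ((-1 : ℂ) ^ (P.parts.card - 1) * ((P.parts.card - 1).factorial : ℂ)) •
      (P.parts.toList.map fun A => heisenbergOn ħ Φ (declusterize j A) t).prod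

/-- The solution of the dual BBGKY hierarchy with initial data `G`:
`G_s(t, Y) = ∑_{n=0}^s 1/(s-n)! ∑_{j₁≠…≠j_{s-n}} 𝔄⁺_{1+n}(t, (Y∖X)₁, X) G_{s-n}(0, Y∖X)` with
`Y∖X = (j₁, …, j_{s-n})`. For `s = 0` the right-hand side is `G_0`. -/
def evolve (ħ : ℝ) {d : ℕ} (Φ : (k : ℕ) → (Fin k → Pos d) → ℝ) (t : ℝ)
    (G : (n : ℕ) → Op d n) (s : ℕ) : Op d s :=
  ∑ n ∈ Finset.range (s + 1), (((s - n).factorial : ℂ))⁻¹ •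
    ∑ j : Fin (s - n) ↪ Fin s, dualCumulant ħ Φ j t (onParticles j (G (s - n)))

/-! ### Spaces of observables and states, and the mean value -/

/-- `g ∈ 𝔏_γ`: symmetric bounded operators with `sup_n γⁿ/n! ‖g_n‖ < ∞`. -/
structure MemObs {d : ℕ} (γ : ℝ) (g : (n : ℕ) → Op d n) : Prop where
  symmetric : ∀ n, IsSymmetricOp (g n)
  bounded : BddAbove (Set.range fun n => γ ^ n / (n.factorial : ℝ) * ‖g n‖)

/-- `‖g‖ = sup_n γⁿ/n! ‖g_n‖`. -/
def obsNorm {d : ℕ} (γ : ℝ) (g : (n : ℕ) → Op d n) : ℝ :=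
  ⨆ n, γ ^ n / (n.factorial : ℝ) * ‖g n‖

/-- `f ∈ 𝔏¹_α`: symmetric trace class operators with `∑_n αⁿ Tr |f_n| < ∞`. -/
structure MemState {d : ℕ} (α : ℝ) (f : (n : ℕ) → Op d n) : Prop where
  symmetric : ∀ n, IsSymmetricOp (f n)
  traceClass : ∀ n, IsTraceClass (f n)
  summable : Summable fun n => α ^ n * (traceNorm (f n)).toReal

/-- `‖f‖ = ∑_n αⁿ Tr |f_n|`. -/
def stateNorm {d : ℕ} (α : ℝ) (f : (n : ℕ) → Op d n) : ℝ :=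
  ∑' n, α ^ n * (traceNorm (f n)).toReal

/-- The `s`-th term `1/s! Tr (G_s F_s)` of the mean value functional. -/
def meanTerm {d : ℕ} (G F : (n : ℕ) → Op d n) (s : ℕ) : ℂ :=
  ((s.factorial : ℂ))⁻¹ * trace (G s * F s)

/-- The mean value functional `⟨G|F⟩ = ∑_s 1/s! Tr (G_s F_s)`. -/
def meanValue {d : ℕ} (G F : (n : ℕ) → Op d n) : ℂ := ∑' s, meanTerm G F s

/-- The number of particles as a marginal observable, `N = (0, I, 0, 0, …)`. -/
def numberObs (d : ℕ) (n : ℕ) : Op d n := if n = 1 then 1 else 0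

end DualBBGKY

end

/-!
Two facts carry the proof.

*Combinatorics of cumulants.* A partition of a set into `k` blocks extends to one more point in `k`
ways that keep the number of blocks and in one way that adds a block (`sum_finpartition_insert`).
This recursion gives `∑_P (|P| - 1)! ≤ 2ⁿ⁺¹ n! ≤ eⁿ⁺² n!` over the partitions of `n + 1` elements,
and it makes the coefficients `(-1)^{|P|-1} (|P|-1)!` add up to zero as soon as there are at least
two elements. Only two properties of the evolution `U g U⁻¹` are needed, both consequences of
unitarity: it does not increase the operator norm and it fixes the identity. The bound therefore
controls the dual cumulants: there are `s! / (s - k)!` ordered clusters of `k = s - n` particles,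
so that
`‖G_s(t)‖ / s! ≤ γ⁻ˢ ∑_n 2ⁿ⁺¹ γⁿ ‖G(0)‖ ≤ γ⁻ˢ e² (1 - γ e)⁻¹ ‖G(0)‖` (`norm_evolve_le`).
The cancellation shows that the number of particles, whose only nonzero component is the identity of
one particle, does not evolve (`evolve_numberObs`).

*Trace class operators form an ideal.* Operator monotonicity of the square root gives
`|A T| ≤ ‖A‖ |T|`, hence `Tr |A T| ≤ ‖A‖ Tr |T|` (`traceNorm_mul_le`). The inequality
`|Tr T| ≤ Tr |T|` (`norm_trace_le`) follows from a factorization `T = V |T|` with a contraction `V`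
and from the equality of the Hilbert--Schmidt norms of an operator and of its adjoint.

Together, the `s`-th term of the mean value is at most
`e² (1 - γ e)⁻¹ ‖G(0)‖ · γ⁻ˢ Tr |F_s|`, and the last factors add up to the norm of `F(0)`.
-/

noncomputable section

namespace DualBBGKY

/-! ### The trace norm as an operator ideal norm -/

section TraceIdeal

variable {E : Type*} [NormedAddCommGroup E] [InnerProductSpace ℂ E] [CompleteSpace E]

/-- Parseval's identity with values in `[0, ∞]`. -/
theorem tsum_enorm_inner_sq (x : E) : ∑' i, ‖inner ℂ (basis E i) x‖ₑ ^ 2 = ‖x‖ₑ ^ 2 := by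
  have h : HasSum (fun i => ‖inner ℂ (basis E i) x‖ ^ 2) (‖x‖ ^ 2) := by
    have h1 := (basis E).hasSum_inner_mul_inner x x
    have h2 := (RCLike.hasSum_re ℂ h1)
    rw [inner_self_eq_norm_sq] at h2
    refine h2.congr_fun fun i => ?_
    rw [← inner_conj_symm x, RCLike.conj_mul]
    norm_cast
  have h3 := ENNReal.ofReal_tsum_of_nonneg (fun i => by positivity) h.summable
  rw [h.tsum_eq] at h3
  simp only [ENNReal.ofReal_pow (norm_nonneg _), ofReal_norm] at h3
  exact h3.symm

/-- An operator and its adjoint have the same Hilbert--Schmidt norm. -/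
theorem tsum_enorm_sq_adjoint (A : E →L[ℂ] E) :
    ∑' i, ‖A (basis E i)‖ₑ ^ 2 = ∑' i, ‖ContinuousLinearMap.adjoint A (basis E i)‖ₑ ^ 2 := by
  rw [← tsum_congr fun i => tsum_enorm_inner_sq (A (basis E i)),
    ← tsum_congr fun i => tsum_enorm_inner_sq (ContinuousLinearMap.adjoint A (basis E i)),
    ENNReal.tsum_comm]
  refine tsum_congr fun i => tsum_congr fun k => ?_
  rw [ContinuousLinearMap.adjoint_inner_right, ← ofReal_norm, norm_inner_symm, ofReal_norm]

/-- Polar decomposition, in the weak form `T = V |T|` with a contraction `V`. -/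
theorem exists_contraction_mul_abs (T : E →L[ℂ] E) :
    ∃ V : E →L[ℂ] E, ‖V‖ ≤ 1 ∧ T = V * CFC.abs T := by
  set P := CFC.abs T with hP
  have hPsa : ContinuousLinearMap.adjoint P = P :=
    (IsSelfAdjoint.of_nonneg (CFC.abs_nonneg T)).star_eq
  have hnorm : ∀ x, ‖T x‖ = ‖P x‖ := by
    intro x
    have h : inner ℂ (T x) (T x) = inner ℂ (P x) (P x) := by
      rw [← ContinuousLinearMap.adjoint_inner_right T, ← ContinuousLinearMap.adjoint_inner_right P,
        hPsa]
      exact congrArg (fun A : E →L[ℂ] E => inner ℂ x (A x)) (CFC.abs_mul_abs T).symm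
    rw [inner_self_eq_norm_sq_to_K, inner_self_eq_norm_sq_to_K] at h
    have h' : ‖T x‖ ^ 2 = ‖P x‖ ^ 2 := by exact_mod_cast h
    exact (pow_left_inj₀ (norm_nonneg _) (norm_nonneg _) two_ne_zero).1 h'
  let R : Submodule ℂ E := P.range.topologicalClosure
  have : CompleteSpace R := P.range.isClosed_topologicalClosure.completeSpace_coe
  let e : E →ₗ[ℂ] R := P.toLinearMap.codRestrict R fun x =>
    P.range.le_topologicalClosure ⟨x, rfl⟩
  have hdense : DenseRange e := by
    intro y
    rw [closure_subtype, ← Set.range_comp]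
    exact y.2
  have hle : ∀ x, ‖T.toLinearMap x‖ ≤ 1 * ‖e x‖ := fun x => by
    rw [one_mul]; exact (hnorm x).le
  refine ⟨T.toLinearMap.extendOfNorm e ∘L R.orthogonalProjectionOnto, ?_, ?_⟩
  · refine ContinuousLinearMap.opNorm_le_bound _ zero_le_one fun x => ?_
    refine (LinearMap.norm_extendOfNorm_apply_le hdense 1 hle _).trans ?_
    gcongr
    exact R.norm_orthogonalProjectionOnto_apply_le x
  · ext x
    have hx : R.orthogonalProjectionOnto (P x) = e x :=
      R.orthogonalProjectionOnto_mem_subspace_eq_self (e x)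
    change T x = T.toLinearMap.extendOfNorm e (R.orthogonalProjectionOnto (P x))
    rw [hx, LinearMap.extendOfNorm_eq hdense ⟨1, hle⟩]
    rfl

/-- The trace norm of `T` is the squared Hilbert--Schmidt norm of `|T|^{1/2}`. -/
theorem traceNorm_eq_tsum_sqrt (T : E →L[ℂ] E) :
    traceNorm T = ∑' i, ‖CFC.sqrt (CFC.abs T) (basis E i)‖ₑ ^ 2 := by
  refine tsum_congr fun i => ?_
  set R := CFC.sqrt (CFC.abs T)
  have hR : ContinuousLinearMap.adjoint R = R :=
    (IsSelfAdjoint.of_nonneg (CFC.sqrt_nonneg (CFC.abs T))).star_eq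
  have h : CFC.abs T = R * R := (CFC.sqrt_mul_sqrt_self _ (CFC.abs_nonneg T)).symm
  rw [h, mul_apply_eq_comp, ← ContinuousLinearMap.adjoint_inner_left, hR,
    ← ofReal_norm, ← ENNReal.ofReal_pow (norm_nonneg _)]
  congr 1
  exact inner_self_eq_norm_sq (𝕜 := ℂ) _

/-- The diagonal of `T` is summable in absolute value, with sum at most `Tr |T|`. Writing
`T = V R R` with `R = |T|^{1/2}`, the `i`-th entry is `⟨R V* eᵢ, R eᵢ⟩`, and `R V*` has the same
Hilbert--Schmidt norm as `V R`, hence at most that of `R`. -/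
theorem tsum_enorm_inner_le_traceNorm (T : E →L[ℂ] E) :
    ∑' i, ‖inner ℂ (basis E i) (T (basis E i))‖ₑ ≤ traceNorm T := by
  obtain ⟨V, hV, hT⟩ := exists_contraction_mul_abs T
  set R := CFC.sqrt (CFC.abs T) with hRdef
  have hR : ContinuousLinearMap.adjoint R = R :=
    (IsSelfAdjoint.of_nonneg (CFC.sqrt_nonneg (CFC.abs T))).star_eq
  have hRR : CFC.abs T = R * R := (CFC.sqrt_mul_sqrt_self _ (CFC.abs_nonneg T)).symm
  have hadj : ContinuousLinearMap.adjoint (V * R) = R * ContinuousLinearMap.adjoint V := by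
    change ContinuousLinearMap.adjoint (V ∘L R) = _
    rw [ContinuousLinearMap.adjoint_comp, hR]
    rfl
  have hterm : ∀ i, ‖inner ℂ (basis E i) (T (basis E i))‖ₑ ≤
      2⁻¹ * (‖ContinuousLinearMap.adjoint (V * R) (basis E i)‖ₑ ^ 2 + ‖R (basis E i)‖ₑ ^ 2) := by
    intro i
    have h1 : inner ℂ (basis E i) (T (basis E i)) =
        inner ℂ (ContinuousLinearMap.adjoint (V * R) (basis E i)) (R (basis E i)) := by
      rw [ContinuousLinearMap.adjoint_inner_left]
      conv_lhs => rw [hT, hRR]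
      rfl
    have h2 : ‖inner ℂ (basis E i) (T (basis E i))‖ ≤ 2⁻¹ *
        (‖ContinuousLinearMap.adjoint (V * R) (basis E i)‖ ^ 2 + ‖R (basis E i)‖ ^ 2) := by
      rw [h1]
      refine (norm_inner_le_norm _ _).trans ?_
      nlinarith [sq_nonneg (‖ContinuousLinearMap.adjoint (V * R) (basis E i)‖ -
        ‖R (basis E i)‖)]
    have h3 := ENNReal.ofReal_le_ofReal h2
    rwa [ENNReal.ofReal_mul (by norm_num), ENNReal.ofReal_add (by positivity) (by positivity),
      ENNReal.ofReal_pow (norm_nonneg _), ENNReal.ofReal_pow (norm_nonneg _), ofReal_norm,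
      ofReal_norm, ofReal_norm, ENNReal.ofReal_inv_of_pos (by norm_num),
      ENNReal.ofReal_ofNat] at h3
  have hVR : ∑' i, ‖ContinuousLinearMap.adjoint (V * R) (basis E i)‖ₑ ^ 2 ≤ traceNorm T := by
    rw [← tsum_enorm_sq_adjoint, traceNorm_eq_tsum_sqrt]
    refine ENNReal.tsum_le_tsum fun i => ?_
    gcongr
    rw [← ofReal_norm, ← ofReal_norm]
    refine ENNReal.ofReal_le_ofReal ?_
    calc ‖V (R (basis E i))‖ ≤ 1 * ‖R (basis E i)‖ := V.le_of_opNorm_le hV _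
      _ = _ := one_mul _
  calc _ ≤ ∑' i, 2⁻¹ * (‖ContinuousLinearMap.adjoint (V * R) (basis E i)‖ₑ ^ 2 +
        ‖R (basis E i)‖ₑ ^ 2) := ENNReal.tsum_le_tsum hterm
    _ = 2⁻¹ * (∑' i, ‖ContinuousLinearMap.adjoint (V * R) (basis E i)‖ₑ ^ 2 + traceNorm T) := by
        rw [ENNReal.tsum_mul_left, ENNReal.tsum_add, traceNorm_eq_tsum_sqrt]
    _ ≤ 2⁻¹ * (traceNorm T + traceNorm T) := by gcongr
    _ = traceNorm T := by
        rw [← two_mul, ← mul_assoc, ENNReal.inv_mul_cancel (by norm_num) (by norm_num), one_mul]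

theorem norm_trace_le {T : E →L[ℂ] E} (hT : IsTraceClass T) :
    ‖trace T‖ ≤ (traceNorm T).toReal := by
  have hle := tsum_enorm_inner_le_traceNorm T
  have hne : ∑' i, ‖inner ℂ (basis E i) (T (basis E i))‖ₑ ≠ ⊤ := (hle.trans_lt hT).ne
  have hs : Summable fun i => ‖inner ℂ (basis E i) (T (basis E i))‖ := by
    simpa using ENNReal.summable_toReal hne
  refine (norm_tsum_le_tsum_norm hs).trans ?_
  have h := ENNReal.toReal_mono hT.ne hle
  rw [ENNReal.tsum_toReal_eq fun i => enorm_ne_top] at h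
  simpa using h

/-- Since `T* A* A T ≤ ‖A‖² T* T`, operator monotonicity of the square root gives
`|A T| ≤ ‖A‖ |T|`. -/
theorem abs_mul_le (A T : E →L[ℂ] E) : CFC.abs (A * T) ≤ ‖A‖ • CFC.abs T := by
  have h1 : star (A * T) * (A * T) ≤ (‖A‖ • CFC.abs T) * (‖A‖ • CFC.abs T) := by
    have h := star_left_conjugate_le_conjugate
      (CStarAlgebra.star_mul_le_algebraMap_norm_sq (a := A)) T
    rw [smul_mul_smul_comm, CFC.abs_mul_abs, star_mul]
    simpa [Algebra.algebraMap_eq_smul_one, mul_assoc, pow_two] using h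
  have h2 := CFC.sqrt_le_sqrt _ _ h1
  rwa [CFC.sqrt_mul_self _ (smul_nonneg (norm_nonneg A) (CFC.abs_nonneg T))] at h2

theorem traceNorm_mul_le (A T : E →L[ℂ] E) :
    traceNorm (A * T) ≤ ENNReal.ofReal ‖A‖ * traceNorm T := by
  unfold traceNorm
  rw [← ENNReal.tsum_mul_left]
  refine ENNReal.tsum_le_tsum fun i => ?_
  rw [← ENNReal.ofReal_mul (norm_nonneg A)]
  refine ENNReal.ofReal_le_ofReal ?_
  have h := ((ContinuousLinearMap.le_def _ _).1 (abs_mul_le A T)).re_inner_nonneg_right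
    (basis E i)
  simp only [sub_apply, inner_sub_right, smul_apply,
    map_sub, sub_nonneg] at h
  refine h.trans (le_of_eq ?_)
  simp [inner_smul_right_eq_smul]

theorem isTraceClass_mul (A : E →L[ℂ] E) {T : E →L[ℂ] E} (hT : IsTraceClass T) :
    IsTraceClass (A * T) :=
  (traceNorm_mul_le A T).trans_lt (ENNReal.mul_lt_top ENNReal.ofReal_lt_top hT)

theorem norm_trace_mul_le (A : E →L[ℂ] E) {T : E →L[ℂ] E} (hT : IsTraceClass T) :
    ‖trace (A * T)‖ ≤ ‖A‖ * (traceNorm T).toReal := by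
  refine (norm_trace_le (isTraceClass_mul A hT)).trans ?_
  have h := ENNReal.toReal_mono (ENNReal.mul_ne_top ENNReal.ofReal_ne_top hT.ne)
    (traceNorm_mul_le A T)
  rwa [ENNReal.toReal_mul, ENNReal.toReal_ofReal (norm_nonneg A)] at h

end TraceIdeal

/-! ### Sums over partitions of a finite set -/

section Partitions

variable {α : Type*} [DecidableEq α] {a : α} {s : Finset α}

/-- The partition of `insert a s` obtained from a partition of `s` by adding the block `{a}`. -/
def addSingleton (ha : a ∉ s) (Q : Finpartition s) : Finpartition (insert a s) :=
  Q.extend (b := {a}) (singleton_ne_empty a) (disjoint_singleton_right.2 ha)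
    (by rw [sup_eq_union, union_comm, insert_eq])

/-- The partition of `insert a s` obtained from a partition of `s` by putting `a` into the
block `B`. -/
def addToBlock (ha : a ∉ s) (Q : Finpartition s) {B : Finset α} (hB : B ∈ Q.parts) :
    Finpartition (insert a s) :=
  Finpartition.ofExistsUnique (insert (insert a B) (Q.parts.erase B))
    (by
      intro p hp
      rcases mem_insert.1 hp with rfl | hp
      · exact insert_subset_insert a (Q.subset hB)
      · exact (Q.subset (mem_of_mem_erase hp)).trans (subset_insert a s))
    (by
      intro x hx
      rcases mem_insert.1 hx with rfl | hx
      · refine ⟨insert x B, ⟨mem_insert_self _ _, mem_insert_self _ _⟩, ?_⟩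
        rintro p ⟨hp, hxp⟩
        rcases mem_insert.1 hp with rfl | hp
        · rfl
        · exact absurd (Q.subset (mem_of_mem_erase hp) hxp) ha
      · have hxa : x ≠ a := fun h => ha (h ▸ hx)
        obtain ⟨p, hp, hxp⟩ := Q.exists_mem hx
        by_cases hpB : p = B
        · subst hpB
          refine ⟨insert a p, ⟨mem_insert_self _ _, mem_insert_of_mem hxp⟩, ?_⟩
          rintro q ⟨hq, hxq⟩
          rcases mem_insert.1 hq with rfl | hq
          · rfl
          · exact absurd (Q.eq_of_mem_parts (mem_of_mem_erase hq) hp hxq hxp) (ne_of_mem_erase hq)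
        · refine ⟨p, ⟨mem_insert_of_mem (mem_erase.2 ⟨hpB, hp⟩), hxp⟩, ?_⟩
          rintro q ⟨hq, hxq⟩
          rcases mem_insert.1 hq with rfl | hq
          · exact absurd (Q.eq_of_mem_parts hp hB hxp (mem_of_mem_insert_of_ne hxq hxa)) hpB
          · exact Q.eq_of_mem_parts (mem_of_mem_erase hq) hp hxq hxp)
    (by
      intro h
      rcases mem_insert.1 h with h | h
      · exact insert_ne_empty a B h.symm
      · exact Q.empty_notMem_parts (mem_of_mem_erase h))

theorem parts_addToBlock (ha : a ∉ s) (Q : Finpartition s) {B : Finset α} (hB : B ∈ Q.parts) :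
    (addToBlock ha Q hB).parts = insert (insert a B) (Q.parts.erase B) := rfl

theorem card_parts_addSingleton (ha : a ∉ s) (Q : Finpartition s) :
    #(addSingleton ha Q).parts = #Q.parts + 1 :=
  Q.card_extend _ _

theorem card_parts_addToBlock (ha : a ∉ s) (Q : Finpartition s) {B : Finset α}
    (hB : B ∈ Q.parts) : #(addToBlock ha Q hB).parts = #Q.parts := by
  rw [parts_addToBlock, card_insert_of_notMem, card_erase_add_one hB]
  exact fun h => ha (Q.subset (mem_of_mem_erase h) (mem_insert_self a B))

/-- The partition of `s` obtained from a partition of `insert a s` by removing `a`. -/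
def removePoint (ha : a ∉ s) (P : Finpartition (insert a s)) : Finpartition s :=
  (P.avoid {a}).copy (by rw [← erase_eq, erase_insert ha])

theorem mem_parts_removePoint (ha : a ∉ s) (P : Finpartition (insert a s)) {c : Finset α} :
    c ∈ (removePoint ha P).parts ↔ ∃ p ∈ P.parts, ¬ p ⊆ {a} ∧ p.erase a = c := by
  simp only [erase_eq]
  exact P.mem_avoid

theorem notMem_of_mem_parts (ha : a ∉ s) (Q : Finpartition s) {B : Finset α}
    (hB : B ∈ Q.parts) : a ∉ B := fun h => ha (Q.subset hB h)

theorem not_subset_singleton (ha : a ∉ s) (Q : Finpartition s) {B : Finset α}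
    (hB : B ∈ Q.parts) : ¬ B ⊆ {a} := by
  obtain ⟨x, hx⟩ := Q.nonempty_of_mem_parts hB
  intro h
  exact notMem_of_mem_parts ha Q hB (mem_singleton.1 (h hx) ▸ hx)

theorem removePoint_addSingleton (ha : a ∉ s) (Q : Finpartition s) :
    removePoint ha (addSingleton ha Q) = Q := by
  ext c
  rw [mem_parts_removePoint]
  constructor
  · rintro ⟨p, hp, hpa, rfl⟩
    rcases mem_insert.1 hp with rfl | hp
    · exact absurd Subset.rfl hpa
    · rwa [erase_eq_of_notMem (notMem_of_mem_parts ha Q hp)]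
  · intro hc
    exact ⟨c, mem_insert_of_mem hc, not_subset_singleton ha Q hc,
      erase_eq_of_notMem (notMem_of_mem_parts ha Q hc)⟩

theorem removePoint_addToBlock (ha : a ∉ s) (Q : Finpartition s) {B : Finset α}
    (hB : B ∈ Q.parts) : removePoint ha (addToBlock ha Q hB) = Q := by
  ext c
  rw [mem_parts_removePoint, parts_addToBlock]
  constructor
  · rintro ⟨p, hp, hpa, rfl⟩
    rcases mem_insert.1 hp with rfl | hp
    · rwa [erase_insert (notMem_of_mem_parts ha Q hB)]
    · have hp' := mem_of_mem_erase hp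
      rwa [erase_eq_of_notMem (notMem_of_mem_parts ha Q hp')]
  · intro hc
    by_cases hcB : c = B
    · subst hcB
      exact ⟨insert a c, mem_insert_self _ _,
        fun h => not_subset_singleton ha Q hc ((subset_insert a c).trans h),
        erase_insert (notMem_of_mem_parts ha Q hc)⟩
    · exact ⟨c, mem_insert_of_mem (mem_erase.2 ⟨hcB, hc⟩), not_subset_singleton ha Q hc,
        erase_eq_of_notMem (notMem_of_mem_parts ha Q hc)⟩

/-- A partition of `insert a s` arises from one of `s` either by adding the block `{a}` or by
putting `a` into one of the blocks. -/
def extendPartition (ha : a ∉ s) (x : Σ Q : Finpartition s, Option {B // B ∈ Q.parts}) :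
    Finpartition (insert a s) :=
  x.2.elim (addSingleton ha x.1) fun B => addToBlock ha x.1 B.2

theorem removePoint_extendPartition (ha : a ∉ s)
    (x : Σ Q : Finpartition s, Option {B // B ∈ Q.parts}) :
    removePoint ha (extendPartition ha x) = x.1 := by
  obtain ⟨Q, _ | B⟩ := x
  · exact removePoint_addSingleton ha Q
  · exact removePoint_addToBlock ha Q B.2

theorem part_addSingleton (ha : a ∉ s) (Q : Finpartition s) :
    (addSingleton ha Q).part a = {a} :=
  (addSingleton ha Q).part_eq_of_mem (mem_insert_self _ _) (mem_singleton_self a)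

theorem part_addToBlock (ha : a ∉ s) (Q : Finpartition s) {B : Finset α} (hB : B ∈ Q.parts) :
    (addToBlock ha Q hB).part a = insert a B :=
  (addToBlock ha Q hB).part_eq_of_mem (mem_insert_self _ _) (mem_insert_self a B)

theorem extendPartition_injective (ha : a ∉ s) : Function.Injective (extendPartition ha) := by
  rintro ⟨Q, o⟩ ⟨Q', o'⟩ h
  have hQ : Q = Q' := by
    have := congrArg (removePoint ha) h
    rwa [removePoint_extendPartition, removePoint_extendPartition] at this
  subst hQ
  have hpart := congrArg (fun P : Finpartition (insert a s) => (P.part a).erase a) h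
  rcases o with _ | ⟨B, hB⟩ <;> rcases o' with _ | ⟨B', hB'⟩
  · rfl
  · simp only [extendPartition, Option.elim, part_addSingleton, part_addToBlock,
      erase_insert (notMem_of_mem_parts ha Q hB'), erase_singleton] at hpart
    exact absurd hpart.symm (Q.ne_empty hB')
  · simp only [extendPartition, Option.elim, part_addSingleton, part_addToBlock,
      erase_insert (notMem_of_mem_parts ha Q hB), erase_singleton] at hpart
    exact absurd hpart (Q.ne_empty hB)
  · simp only [extendPartition, Option.elim, part_addToBlock,
      erase_insert (notMem_of_mem_parts ha Q hB),
      erase_insert (notMem_of_mem_parts ha Q hB')] at hpart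
    subst hpart
    rfl

theorem extendPartition_surjective (ha : a ∉ s) : Function.Surjective (extendPartition ha) := by
  intro P
  have haP : a ∈ P.part a := P.mem_part_self.2 (mem_insert_self a s)
  have hmem : P.part a ∈ P.parts := P.part_mem.2 (mem_insert_self a s)
  have hother : ∀ p ∈ P.parts, p ≠ P.part a → a ∉ p := fun p hp hne hap =>
    hne (P.part_eq_of_mem hp hap).symm
  have hne : ∀ p ∈ P.parts, p ≠ P.part a → ¬ p ⊆ {a} := by
    intro p hp hpa h
    obtain ⟨x, hx⟩ := P.nonempty_of_mem_parts hp
    exact hother p hp hpa (mem_singleton.1 (h hx) ▸ hx)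
  by_cases hs : P.part a ⊆ {a}
  · have hs' : P.part a = {a} :=
      hs.antisymm (singleton_subset_iff.2 haP)
    refine ⟨⟨removePoint ha P, none⟩, ?_⟩
    ext c
    change c ∈ insert {a} (removePoint ha P).parts ↔ _
    rw [mem_insert, mem_parts_removePoint]
    constructor
    · rintro (rfl | ⟨p, hp, hpa, rfl⟩)
      · rwa [← hs']
      · rwa [erase_eq_of_notMem (hother p hp (by rintro rfl; exact hpa hs))]
    · intro hc
      by_cases hca : c = P.part a
      · exact Or.inl (hca.trans hs')
      · exact Or.inr ⟨c, hc, hne c hc hca, erase_eq_of_notMem (hother c hc hca)⟩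
  · have hB : (P.part a).erase a ∈ (removePoint ha P).parts :=
      (mem_parts_removePoint ha P).2 ⟨_, hmem, hs, rfl⟩
    refine ⟨⟨removePoint ha P, some ⟨_, hB⟩⟩, ?_⟩
    ext c
    change c ∈ (addToBlock ha _ hB).parts ↔ _
    rw [parts_addToBlock, mem_insert, mem_erase, mem_parts_removePoint, insert_erase haP]
    constructor
    · rintro (rfl | ⟨hc, p, hp, hpa, rfl⟩)
      · exact hmem
      · rwa [erase_eq_of_notMem (hother p hp (by rintro rfl; exact hc rfl))]
    · intro hc
      by_cases hca : c = P.part a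
      · exact Or.inl hca
      · have hac := hother c hc hca
        refine Or.inr ⟨?_, c, hc, hne c hc hca, erase_eq_of_notMem hac⟩
        rintro rfl
        obtain ⟨x, hx⟩ := P.nonempty_of_mem_parts hc
        exact hca (P.eq_of_mem_parts hc hmem hx (mem_of_mem_erase hx))

/-- The recursion of the Stirling numbers: a partition of `s` into `k` blocks extends to
`insert a s` in `k` ways with `k` blocks and in one way with `k + 1` blocks. -/
theorem sum_finpartition_insert {M : Type*} [AddCommMonoid M] (ha : a ∉ s) (w : ℕ → M) :
    ∑ P : Finpartition (insert a s), w #P.parts =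
      ∑ Q : Finpartition s, (w (#Q.parts + 1) + #Q.parts • w #Q.parts) := by
  rw [← Fintype.sum_bijective (extendPartition ha)
    ⟨extendPartition_injective ha, extendPartition_surjective ha⟩ _ _ (fun _ => rfl),
    Fintype.sum_sigma]
  refine Fintype.sum_congr _ _ fun Q => ?_
  rw [Fintype.sum_option]
  congr 1
  · exact congrArg w (card_parts_addSingleton ha Q)
  · refine (Fintype.sum_congr _ (fun _ => w #Q.parts) fun B =>
      congrArg w (card_parts_addToBlock ha Q B.2)).trans ?_
    rw [Finset.sum_const, Finset.card_univ, Fintype.card_coe]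

theorem sum_finpartition_empty {M : Type*} [AddCommMonoid M] (w : ℕ → M) :
    ∑ P : Finpartition (∅ : Finset α), w #P.parts = w 0 :=
   Fintype.sum_subsingleton (fun P : Finpartition (⊥ : Finset α) => w #P.parts)
    (Finpartition.empty (Finset α))

/-- Each new point multiplies the number of ordered partitions into `k` blocks by at most
`k + (k + 1)`. -/
theorem sum_factorial_card_parts_le (s : Finset α) :
    ∑ P : Finpartition s, (#P.parts).factorial ≤ 2 ^ #s * (#s).factorial := by
  induction s using Finset.induction_on with
  | empty => rw [sum_finpartition_empty]; simp
  | insert a s ha ih =>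
    rw [sum_finpartition_insert ha, card_insert_of_notMem ha]
    calc _ ≤ ∑ Q : Finpartition s, 2 * (#s + 1) * (#Q.parts).factorial := by
          refine Finset.sum_le_sum fun Q _ => ?_
          have hQ := Q.card_parts_le_card
          rw [Nat.factorial_succ, smul_eq_mul, ← add_mul]
          gcongr
          omega
      _ = 2 * (#s + 1) * ∑ Q : Finpartition s, (#Q.parts).factorial := by rw [Finset.mul_sum]
      _ ≤ 2 * (#s + 1) * (2 ^ #s * (#s).factorial) := by gcongr
      _ = _ := by rw [Nat.factorial_succ]; ring

theorem card_parts_pos (hs : s.Nonempty) (Q : Finpartition s) : 0 < #Q.parts :=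
  card_pos.2 (Q.parts_nonempty hs.ne_empty)

theorem sum_factorial_pred_card_parts_le {n : ℕ} (hs : #s = n + 1) :
    ∑ P : Finpartition s, (#P.parts - 1).factorial ≤ 2 ^ (n + 1) * n.factorial := by
  obtain ⟨a, r, ha, rfl, hr⟩ := card_eq_succ.1 hs
  rw [sum_finpartition_insert ha (fun k => (k - 1).factorial)]
  calc _ ≤ ∑ Q : Finpartition r, 2 * (#Q.parts).factorial := by
        refine Finset.sum_le_sum fun Q _ => ?_
        rw [Nat.add_sub_cancel, smul_eq_mul, two_mul]
        rcases Nat.eq_zero_or_pos #Q.parts with h | h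
        · simp [h]
        · rw [Nat.mul_factorial_pred h.ne']
    _ = 2 * ∑ Q : Finpartition r, (#Q.parts).factorial := by rw [Finset.mul_sum]
    _ ≤ 2 * (2 ^ n * n.factorial) := by
        have := sum_factorial_card_parts_le r
        rw [hr] at this
        gcongr
    _ = _ := by ring

/-- The Möbius coefficients of the partition lattice add up to zero: extending a partition by one
point, the `k` ways that keep the number `k` of blocks cancel the one that adds a block. -/
theorem sum_mobius_card_parts_eq_zero (hs : 1 < #s) :
    ∑ P : Finpartition s, ((-1 : ℂ) ^ (#P.parts - 1) * ((#P.parts - 1).factorial : ℂ)) = 0 := by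
  obtain ⟨a, has⟩ := card_pos.1 (zero_lt_one.trans hs)
  obtain ⟨r, ha, rfl⟩ : ∃ r, a ∉ r ∧ insert a r = s := ⟨s.erase a, notMem_erase a s,
    insert_erase has⟩
  rw [card_insert_of_notMem ha] at hs
  rw [sum_finpartition_insert ha (fun k => (-1 : ℂ) ^ (k - 1) * ((k - 1).factorial : ℂ))]
  refine Finset.sum_eq_zero fun Q _ => ?_
  obtain ⟨k, hk⟩ := Nat.exists_eq_succ_of_ne_zero
    (card_parts_pos (card_pos.1 (by omega : 0 < #r)) Q).ne'
  rw [hk, Nat.succ_eq_add_one, Nat.add_sub_cancel, Nat.add_sub_cancel, Nat.factorial_succ, pow_succ,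
    nsmul_eq_mul]
  push_cast
  ring

theorem sum_mobius_card_parts_eq_one (hs : #s = 1) :
    ∑ P : Finpartition s, ((-1 : ℂ) ^ (#P.parts - 1) * ((#P.parts - 1).factorial : ℂ)) = 1 := by
  obtain ⟨a, rfl⟩ := card_eq_one.1 hs
  have h := sum_finpartition_insert (notMem_empty a)
    (fun k => (-1 : ℂ) ^ (k - 1) * ((k - 1).factorial : ℂ))
  rw [sum_finpartition_empty (fun k => (-1 : ℂ) ^ (k + 1 - 1) * ((k + 1 - 1).factorial : ℂ) +
    k • ((-1 : ℂ) ^ (k - 1) * ((k - 1).factorial : ℂ)))] at h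
  refine Eq.trans h ?_
  simp

end Partitions

/-! ### Operators acting on some of the particles -/

section OnParticles

variable {d k s : ℕ} (j : Fin k ↪ Fin s)

theorem eq_onParticles {T : Op d k} {B : Op d s}
    (h : ∀ φ ψ, B (tensorVec (splitEquiv_measurePreserving d j) ψ φ) =
      tensorVec (splitEquiv_measurePreserving d j) ψ (T φ)) : B = onParticles j T :=
  (existsUnique_ampliation (splitEquiv_measurePreserving d j) T).unique h
    (onParticles_tensorVec j T)

theorem norm_onParticles_le (T : Op d k) : ‖onParticles j T‖ ≤ ‖T‖ := by
  obtain ⟨B, hB, h⟩ := exists_ampliation (splitEquiv_measurePreserving d j) T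
  rwa [eq_onParticles j h] at hB

theorem onParticles_one : onParticles j (1 : Op d k) = 1 :=
  (eq_onParticles j fun _ _ => rfl).symm

theorem onParticles_zero : onParticles j (0 : Op d k) = 0 :=
  norm_le_zero_iff.1 ((norm_onParticles_le j 0).trans_eq norm_zero)

theorem onParticles_mul (S T : Op d k) :
    onParticles j (S * T) = onParticles j S * onParticles j T :=
  (eq_onParticles j fun φ ψ => by
    rw [mul_apply_eq_comp, onParticles_tensorVec, onParticles_tensorVec]; rfl).symm

end OnParticles

/-! ### The Heisenberg evolution is contractive and fixes the identity -/

section Evolution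

/-- The two cases of `expI` are a unitary group and the identity; the bound holds in both, so that
no self-adjointness of `H` has to be known. -/
theorem norm_expI_le {E : Type*} [NormedAddCommGroup E] [InnerProductSpace ℂ E]
    [CompleteSpace E] (H : E →ₗ.[ℂ] E) (t : ℝ) : ‖expI H t‖ ≤ 1 := by
  unfold expI
  split_ifs with h
  · have hU := CStarRing.norm_mem_unitary_mul 1 (h.choose_spec.unitary t)
    rw [mul_one] at hU
    exact hU.trans_le ContinuousLinearMap.norm_id_le
  · exact ContinuousLinearMap.norm_id_le

theorem expI_mul_expI_neg {E : Type*} [NormedAddCommGroup E] [InnerProductSpace ℂ E]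
    [CompleteSpace E] (H : E →ₗ.[ℂ] E) (t : ℝ) : expI H t * expI H (-t) = 1 := by
  unfold expI
  split_ifs with h
  · rw [← h.choose_spec.add, add_neg_cancel, h.choose_spec.zero]
  · exact one_mul 1

variable (ħ : ℝ) {d s : ℕ} (Φ : (k : ℕ) → (Fin k → Pos d) → ℝ)

theorem norm_evolutionOn_le (A : Finset (Fin s)) (t : ℝ) : ‖evolutionOn ħ Φ A t‖ ≤ 1 :=
  (norm_onParticles_le _ _).trans (norm_expI_le _ _)

theorem evolutionOn_mul_evolutionOn_neg (A : Finset (Fin s)) (t : ℝ) :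
    evolutionOn ħ Φ A t * evolutionOn ħ Φ A (-t) = 1 := by
  unfold evolutionOn evolutionOp
  rw [← onParticles_mul, neg_div, expI_mul_expI_neg, onParticles_one]

theorem norm_heisenbergOn_le (A : Finset (Fin s)) (t : ℝ) (g : Op d s) :
    ‖heisenbergOn ħ Φ A t g‖ ≤ ‖g‖ := by
  change ‖evolutionOn ħ Φ A t * g * evolutionOn ħ Φ A (-t)‖ ≤ ‖g‖
  calc _ ≤ ‖evolutionOn ħ Φ A t * g‖ * ‖evolutionOn ħ Φ A (-t)‖ := norm_mul_le _ _
    _ ≤ (‖evolutionOn ħ Φ A t‖ * ‖g‖) * ‖evolutionOn ħ Φ A (-t)‖ := by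
        gcongr; exact norm_mul_le _ _
    _ ≤ (1 * ‖g‖) * 1 := by gcongr <;> exact norm_evolutionOn_le ħ Φ A _
    _ = ‖g‖ := by ring

theorem heisenbergOn_one (A : Finset (Fin s)) (t : ℝ) :
    heisenbergOn ħ Φ A t (1 : Op d s) = 1 := by
  change evolutionOn ħ Φ A t * 1 * evolutionOn ħ Φ A (-t) = 1
  rw [mul_one, evolutionOn_mul_evolutionOn_neg]

theorem norm_prod_heisenbergOn_le (t : ℝ) (g : Op d s) (l : List (Finset (Fin s))) :
    ‖(l.map fun A => heisenbergOn ħ Φ A t).prod g‖ ≤ ‖g‖ := by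
  induction l with
  | nil => exact le_rfl
  | cons A l ih =>
    rw [List.map_cons, List.prod_cons]
    exact (norm_heisenbergOn_le ħ Φ A t _).trans ih

theorem prod_heisenbergOn_one (t : ℝ) (l : List (Finset (Fin s))) :
    (l.map fun A => heisenbergOn ħ Φ A t).prod (1 : Op d s) = 1 := by
  induction l with
  | nil => rfl
  | cons A l ih =>
    rw [List.map_cons, List.prod_cons, Module.End.mul_apply, ih, heisenbergOn_one]

end Evolution

/-! ### Dual cumulants -/

section Cumulants

variable (ħ : ℝ) {d k s : ℕ} (Φ : (k : ℕ) → (Fin k → Pos d) → ℝ) (j : Fin k ↪ Fin s) (t : ℝ)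

theorem card_option_rest [Fintype (Rest j)] :
    #(Finset.univ : Finset (Option (Rest j))) = s - k + 1 := by
  classical
  have h := Fintype.card_congr (labelEquiv j)
  rw [Fintype.card_sum, Fintype.card_fin, Fintype.card_fin] at h
  rw [Finset.card_univ, Fintype.card_option]
  convert congrArg (fun m => m - k + 1) h using 2
  rw [Nat.add_sub_cancel_left]

open Classical in
theorem dualCumulant_apply (g : Op d s) :
    dualCumulant ħ Φ j t g =
      ∑ P : Finpartition (Finset.univ : Finset (Option (Rest j))),
        ((-1 : ℂ) ^ (#P.parts - 1) * ((#P.parts - 1).factorial : ℂ)) •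
          ((P.parts.toList.map (declusterize j)).map fun A => heisenbergOn ħ Φ A t).prod g := by
  unfold dualCumulant
  rw [LinearMap.sum_apply]
  refine Finset.sum_congr rfl fun P _ => ?_
  rw [LinearMap.smul_apply, List.map_map]
  rfl

/-- The dual cumulant over `n + 1` elements is bounded by `∑_P (|P| - 1)!`, which is at most
`n! 2ⁿ⁺¹`. -/
theorem norm_dualCumulant_le (g : Op d s) :
    ‖dualCumulant ħ Φ j t g‖ ≤ (s - k).factorial * 2 ^ (s - k + 1) * ‖g‖ := by
  classical
  rw [dualCumulant_apply]
  refine (norm_sum_le _ _).trans ?_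
  calc _ ≤ ∑ P : Finpartition (Finset.univ : Finset (Option (Rest j))),
        ((#P.parts - 1).factorial : ℝ) * ‖g‖ := by
        refine Finset.sum_le_sum fun P _ => ?_
        rw [norm_smul, norm_mul, norm_pow, norm_neg, norm_one, one_pow, one_mul,
          Complex.norm_natCast]
        gcongr
        exact norm_prod_heisenbergOn_le ħ Φ t g _
    _ = ((∑ P : Finpartition (Finset.univ : Finset (Option (Rest j))),
        (#P.parts - 1).factorial : ℕ) : ℝ) * ‖g‖ := by
        rw [← Finset.sum_mul]; push_cast; rfl
    _ ≤ ((2 ^ (s - k + 1) * (s - k).factorial : ℕ) : ℝ) * ‖g‖ := by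
        gcongr
        exact sum_factorial_pred_card_parts_le (card_option_rest j)
    _ = _ := by push_cast; ring

/-- On the identity every product of evolutions is trivial, so that a cumulant of more than one
element reduces to the vanishing sum of its coefficients. -/
theorem dualCumulant_one_eq_zero (hks : k < s) : dualCumulant ħ Φ j t (1 : Op d s) = 0 := by
  classical
  rw [dualCumulant_apply]
  simp only [prod_heisenbergOn_one]
  rw [← Finset.sum_smul, sum_mobius_card_parts_eq_zero, zero_smul]
  rw [card_option_rest]
  omega

theorem dualCumulant_one_eq_one (hks : k = s) : dualCumulant ħ Φ j t (1 : Op d s) = 1 := by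
  classical
  rw [dualCumulant_apply]
  simp only [prod_heisenbergOn_one]
  rw [← Finset.sum_smul, sum_mobius_card_parts_eq_one, one_smul]
  rw [card_option_rest]
  omega

end Cumulants

/-! ### Evolved observables and mean values -/

section MeanValues

variable (ħ : ℝ) {d : ℕ} (Φ : (k : ℕ) → (Fin k → Pos d) → ℝ) (t : ℝ)

theorem obsNorm_nonneg {γ : ℝ} (hγ : 0 < γ) (G : (n : ℕ) → Op d n) : 0 ≤ obsNorm γ G :=
  Real.iSup_nonneg fun n => by positivity

theorem MemObs.norm_le {γ : ℝ} (hγ : 0 < γ) {G : (n : ℕ) → Op d n} (hG : MemObs γ G) (n : ℕ) :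
    ‖G n‖ ≤ n.factorial * γ⁻¹ ^ n * obsNorm γ G := by
  have h : γ ^ n / (n.factorial : ℝ) * ‖G n‖ ≤ obsNorm γ G := le_ciSup hG.bounded n
  have hn : (0 : ℝ) < n.factorial := by positivity
  calc ‖G n‖ = n.factorial * γ⁻¹ ^ n * (γ ^ n / (n.factorial : ℝ) * ‖G n‖) := by
        rw [inv_pow]; field_simp
    _ ≤ _ := by gcongr

/-- The sum over the ordered choices of a cluster of `k` among `s` particles: there are
`s! / (s - k)!` of them. -/
theorem norm_sum_dualCumulant_le {k s : ℕ} (hks : k ≤ s) (g : Op d k) :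
    ‖((k.factorial : ℂ))⁻¹ • ∑ j : Fin k ↪ Fin s, dualCumulant ħ Φ j t (onParticles j g)‖ ≤
      s.factorial * 2 ^ (s - k + 1) * ((k.factorial : ℝ)⁻¹ * ‖g‖) := by
  rw [norm_smul, norm_inv, Complex.norm_natCast]
  have hcard : Fintype.card (Fin k ↪ Fin s) * (s - k).factorial = s.factorial := by
    rw [Fintype.card_embedding_eq, Fintype.card_fin, Fintype.card_fin, mul_comm,
      Nat.factorial_mul_descFactorial hks]
  calc _ ≤ (k.factorial : ℝ)⁻¹ * ∑ _j : Fin k ↪ Fin s,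
        ((s - k).factorial * 2 ^ (s - k + 1) * ‖g‖) := by
        gcongr
        refine (norm_sum_le _ _).trans (Finset.sum_le_sum fun j _ => ?_)
        refine (norm_dualCumulant_le ħ Φ j t _).trans ?_
        gcongr
        exact norm_onParticles_le j g
    _ = _ := by
        rw [Finset.sum_const, Finset.card_univ, nsmul_eq_mul, ← hcard]
        push_cast
        ring

theorem norm_evolve_le {γ : ℝ} (hγ : 0 < γ) (hγe : γ * Real.exp 1 < 1) {G : (n : ℕ) → Op d n}
    (hG : MemObs γ G) (s : ℕ) :
    ‖evolve ħ Φ t G s‖ ≤ s.factorial * γ⁻¹ ^ s *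
      (Real.exp 1 ^ 2 * (1 - γ * Real.exp 1)⁻¹ * obsNorm γ G) := by
  have hN := obsNorm_nonneg hγ G
  have he : 2 ≤ Real.exp 1 := by have := Real.add_one_le_exp (1 : ℝ); linarith
  have hterm : ∀ n ∈ Finset.range (s + 1), ‖(((s - n).factorial : ℂ))⁻¹ •
      ∑ j : Fin (s - n) ↪ Fin s, dualCumulant ħ Φ j t (onParticles j (G (s - n)))‖ ≤
      s.factorial * γ⁻¹ ^ s * (Real.exp 1 ^ 2 * obsNorm γ G) * (γ * Real.exp 1) ^ n := by
    intro n hn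
    have hns : n ≤ s := Nat.lt_succ_iff.1 (Finset.mem_range.1 hn)
    refine (norm_sum_dualCumulant_le ħ Φ t (Nat.sub_le s n) (G (s - n))).trans ?_
    rw [Nat.sub_sub_self hns]
    have hf : (0 : ℝ) < (s - n).factorial := by positivity
    have hpow : γ⁻¹ ^ (s - n) = γ⁻¹ ^ s * γ ^ n := by
      rw [← Nat.sub_add_cancel hns, pow_add, Nat.add_sub_cancel, mul_assoc, ← mul_pow,
        inv_mul_cancel₀ hγ.ne', one_pow, mul_one]
    -- the combinatorial constant `2ⁿ⁺¹` is at most `eⁿ⁺²`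
    have h2 : (2 : ℝ) ^ (n + 1) ≤ Real.exp 1 ^ (n + 2) :=
      (pow_le_pow_left₀ (by norm_num) he _).trans
        (pow_le_pow_right₀ (one_le_two.trans he) (Nat.le_succ _))
    calc _ ≤ (s.factorial : ℝ) * Real.exp 1 ^ (n + 2) * (((s - n).factorial : ℝ)⁻¹ *
          ((s - n).factorial * γ⁻¹ ^ (s - n) * obsNorm γ G)) := by
          gcongr
          exact hG.norm_le hγ (s - n)
      _ = (s.factorial : ℝ) * Real.exp 1 ^ (n + 2) * (γ⁻¹ ^ s * γ ^ n * obsNorm γ G) := by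
          rw [hpow]; field_simp
      _ = _ := by rw [mul_pow, pow_add]; ring
  refine (norm_sum_le _ _).trans ((Finset.sum_le_sum hterm).trans ?_)
  rw [← Finset.mul_sum]
  have hge : 0 ≤ γ * Real.exp 1 := by positivity
  have hgeom : ∑ n ∈ Finset.range (s + 1), (γ * Real.exp 1) ^ n ≤ (1 - γ * Real.exp 1)⁻¹ := by
    rw [← tsum_geometric_of_lt_one hge hγe]
    exact (summable_geometric_of_lt_one hge hγe).sum_le_tsum _ fun _ _ => by positivity
  calc _ ≤ s.factorial * γ⁻¹ ^ s * (Real.exp 1 ^ 2 * obsNorm γ G) * (1 - γ * Real.exp 1)⁻¹ := by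
        gcongr
    _ = _ := by ring

theorem norm_meanTerm_evolve_le {γ : ℝ} (hγ : 0 < γ) (hγe : γ * Real.exp 1 < 1)
    {G F : (n : ℕ) → Op d n} (hG : MemObs γ G) (hF : ∀ n, IsTraceClass (F n)) (s : ℕ) :
    ‖meanTerm (evolve ħ Φ t G) F s‖ ≤
      Real.exp 1 ^ 2 * (1 - γ * Real.exp 1)⁻¹ * obsNorm γ G *
        (γ⁻¹ ^ s * (traceNorm (F s)).toReal) := by
  unfold meanTerm
  rw [norm_mul, norm_inv, Complex.norm_natCast]
  have hs : (0 : ℝ) < s.factorial := by positivity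
  calc _ ≤ (s.factorial : ℝ)⁻¹ * ((s.factorial * γ⁻¹ ^ s *
        (Real.exp 1 ^ 2 * (1 - γ * Real.exp 1)⁻¹ * obsNorm γ G)) *
          (traceNorm (F s)).toReal) := by
        gcongr
        refine (norm_trace_mul_le _ (hF s)).trans ?_
        gcongr
        exact norm_evolve_le ħ Φ t hγ hγe hG s
    _ = _ := by
        generalize Real.exp 1 ^ 2 * (1 - γ * Real.exp 1)⁻¹ * obsNorm γ G = C
        field_simp

theorem dualCumulant_numberObs {k s : ℕ} (j : Fin k ↪ Fin s) :
    dualCumulant ħ Φ j t (onParticles j (numberObs d k)) = if k = 1 ∧ s = 1 then 1 else 0 := by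
  by_cases hk : k = 1
  · subst hk
    have h1 : numberObs d 1 = 1 := if_pos rfl
    have hs : 1 ≤ s := by simpa using Fintype.card_le_of_embedding j
    rw [h1, onParticles_one]
    by_cases hs1 : s = 1
    · rw [if_pos ⟨rfl, hs1⟩, dualCumulant_one_eq_one ħ Φ j t hs1.symm]
    · rw [if_neg fun h => hs1 h.2, dualCumulant_one_eq_zero ħ Φ j t (by omega)]
  · have h0 : numberObs d k = 0 := if_neg hk
    rw [if_neg fun h => hk h.1, h0, onParticles_zero, map_zero]

theorem evolve_numberObs : evolve ħ Φ t (numberObs d) = numberObs d := by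
  funext s
  unfold evolve
  simp only [dualCumulant_numberObs]
  by_cases hs : s = 1
  · subst hs
    simp [Finset.sum_range_succ, numberObs, Fintype.card_embedding_eq]
  · simp [hs, numberObs]

theorem meanValue_numberObs (F : (n : ℕ) → Op d n) : meanValue (numberObs d) F = trace (F 1) := by
  unfold meanValue
  rw [tsum_eq_single 1]
  · simp [meanTerm, numberObs]
  · intro s hs
    simp [meanTerm, numberObs, hs, trace]

end MeanValues

end DualBBGKY

end

theorem mainTheorem3 (d : ℕ) (hd : 1 ≤ d) (ħ : ℝ) (hħ : 0 < ħ)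
    (Φ : (k : ℕ) → (Fin k → DualBBGKY.Pos d) → ℝ)
    (hΦ : ∀ k, 1 ≤ k → DualBBGKY.IsKatoPotential (Φ k))
    (γ α : ℝ) (hα : α = γ⁻¹) (hαe : Real.exp 1 < α)
    (F : (n : ℕ) → DualBBGKY.Op d n) (hF : DualBBGKY.MemState α F) (t : ℝ) :
    (∀ G : (n : ℕ) → DualBBGKY.Op d n, DualBBGKY.MemObs γ G →
      (∀ s, DualBBGKY.IsTraceClass (DualBBGKY.evolve ħ Φ t G s * F s)) ∧
      Summable (DualBBGKY.meanTerm (DualBBGKY.evolve ħ Φ t G) F) ∧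
      ‖DualBBGKY.meanValue (DualBBGKY.evolve ħ Φ t G) F‖ ≤
        Real.exp 1 ^ 2 * (1 - γ * Real.exp 1)⁻¹ *
          DualBBGKY.obsNorm γ G * DualBBGKY.stateNorm α F) ∧
    DualBBGKY.evolve ħ Φ t (DualBBGKY.numberObs d) = DualBBGKY.numberObs d ∧
    DualBBGKY.meanValue (DualBBGKY.evolve ħ Φ t (DualBBGKY.numberObs d)) F =
      DualBBGKY.trace (F 1) ∧
    ‖DualBBGKY.trace (F 1)‖ ≤ DualBBGKY.stateNorm α F := by
  have hα0 : 0 < α := (Real.exp_pos 1).trans hαe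
  have hα1 : 1 ≤ α := (Real.one_le_exp zero_le_one).trans hαe.le
  have hγ : 0 < γ := inv_pos.1 (hα ▸ hα0)
  have hγe : γ * Real.exp 1 < 1 := by
    calc γ * Real.exp 1 < γ * γ⁻¹ := by rw [← hα]; gcongr
      _ = 1 := mul_inv_cancel₀ hγ.ne'
  refine ⟨fun G hG => ⟨fun s => DualBBGKY.isTraceClass_mul _ (hF.traceClass s), ?_, ?_⟩,
    DualBBGKY.evolve_numberObs ħ Φ t, ?_, ?_⟩
  · have hb := DualBBGKY.norm_meanTerm_evolve_le ħ Φ t hγ hγe hG hF.traceClass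
    rw [← hα] at hb
    exact Summable.of_norm_bounded (hF.summable.mul_left _) hb
  · have hb := DualBBGKY.norm_meanTerm_evolve_le ħ Φ t hγ hγe hG hF.traceClass
    rw [← hα] at hb
    exact tsum_of_norm_bounded (hF.summable.hasSum.mul_left _) hb
  · rw [DualBBGKY.evolve_numberObs, DualBBGKY.meanValue_numberObs]
  · calc ‖DualBBGKY.trace (F 1)‖ ≤ 1 * (DualBBGKY.traceNorm (F 1)).toReal := by
          rw [one_mul]; exact DualBBGKY.norm_trace_le (hF.traceClass 1)
      _ ≤ α ^ 1 * (DualBBGKY.traceNorm (F 1)).toReal := by rw [pow_one]; gcongr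
      _ ≤ DualBBGKY.stateNorm α F := hF.summable.le_tsum 1 fun _ _ => by positivity
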